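/- Let $a<0$, $n\ge 1$ and $\alpha,\beta,\gamma>-1$. The diagonal Jacobi--Angelesco polynomial $P_{n,n}^{(\alpha,\beta,\gamma)}(x;a)$ is the monic real polynomial of degree $2n$ such that, for $k=0,\ldots,n-1$, $$\int_a^0 x^kP_{n,n}^{(\alpha,\beta,\gamma)}(x;a)\,(x-a)^\alpha|x|^\beta(1-x)^\gamma\,dx=0,\qquad \int_0^1 x^kP_{n,n}^{(\alpha,\beta,\gamma)}(x;a)\,(x-a)^\alpha x^\beta(1-x)^\gamma\,dx=0.$$ This polynomial exists, is unique, and has $2n$ distinct real zeros $x_{n,1}<\cdots<x_{n,2n}$, with $x_{n,1},\ldots,x_{n,n}\in(a,0)$ and $x_{n,n+1},\ldots,x_{n,2n}\in(0,1)$. Regarded as functions $x_{n,j}=x_{n,j}(a,\alpha,\beta,\gamma)$ of the parameters, these zeros satisfy: (a) for fixed $a<0$ and $\beta,\gamma>-1$, each zero $x_{n,j}$, $1\le j\le 2n$, is a strictly increasing function of $\alpha\in(-1,\infty)$; (b) if $a=-1$ and $\alpha=\gamma>-1$ is fixed, then each negative zero $x_{n,j}$, $1\le j\le n$, is a strictly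 decreasing function of $\beta\in(-1,\infty)$, and each positive zero $x_{n,j}$, $n+1\le j\le 2n$, is a strictly increasing function of $\beta\in(-1,\infty)$; (c) for fixed $a<0$ and $\alpha,\beta>-1$, each zero $x_{n,j}$, $1\le j\le 2n$, is a strictly decreasing function of $\gamma\in(-1,\infty)$. -/

import Mathlib

open Polynomial Set

/-- `P` is the type II multiple orthogonal polynomial with multi-index `(n, m)` for the weights
`(x - a) ^ α * |x| ^ β * (1 - x) ^ γ` on `[a, 0]` and `(x - a) ^ α * x ^ β * (1 - x) ^ γ` on
`[0, 1]`: it is monic of degree `n + m`, and it is orthogonal to `1, x, …, x ^ (n - 1)` for the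
first weight and to `1, x, …, x ^ (m - 1)` for the second one. -/
structure IsJacobiAngelesco (n m : ℕ) (a α β γ : ℝ) (P : ℝ[X]) : Prop where
  monic : P.Monic
  natDegree_eq : P.natDegree = n + m
  orthogonal_left : ∀ k < n,
    ∫ x in a..0, x ^ k * P.eval x * ((x - a) ^ α * |x| ^ β * (1 - x) ^ γ) = 0
  orthogonal_right : ∀ k < m,
    ∫ x in (0 : ℝ)..1, x ^ k * P.eval x * ((x - a) ^ α * x ^ β * (1 - x) ^ γ) = 0

/-- The Jacobi-Angelesco polynomial `P_{n,m}^{(α,β,γ)}(x; a)`. It exists and is unique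
whenever `a < 0` and `α, β, γ > -1`. -/
noncomputable def jacobiAngelesco (n m : ℕ) (a α β γ : ℝ) : ℝ[X] :=
  Classical.epsilon (IsJacobiAngelesco n m a α β γ)

/-- The real zeros of the diagonal polynomial `P_{n,n}^{(α,β,γ)}(x; a)`, listed with
multiplicity in increasing order, and numbered from `0` to `2 * n - 1`. (The default value `0` is
taken only if there are fewer than `2 * n` real zeros.) -/
noncomputable def jacobiAngelescoZero (n : ℕ) (a α β γ : ℝ) (j : Fin (2 * n)) : ℝ :=
  ((jacobiAngelesco n n a α β γ).roots.sort (· ≤ ·)).getD j 0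

/-! The proof is an induction on the index that trades one degree in each interval for one unit in
each parameter. Let `P`, with zeros `z i`, be the diagonal polynomial of index `n` for parameters `α
+ 1, β + 1, γ + 1`. Differentiating `P` times its weight and dividing by the weight for `α, β, γ`
gives, up to sign, a polynomial orthogonal with index `n + 1` (`IsOrthogonalOn.raise`). Its zeros
are those of `S(x) = (α+1)/(x-a) + (β+1)/x + (γ+1)/(x-1) + ∑ 1/(x - z i)`.

All residues of `S` are positive, so `S` decreases between consecutive poles and has exactly one
zero in each of the `2n + 2` gaps. This yields existence, location and simplicity of the zeros;
uniqueness of the polynomial comes from counting roots of a difference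
(`IsOrthogonalOn.le_card_roots`).

Monotonicity is a comparison: if a parameter change raises `S` at common points of corresponding
gaps and does not move the left ends of these gaps to the left, the zeros move right. Raising `α` or
lowering `γ` raises its own term, and by induction pushes the poles `z i` right, which raises
theirs. For `β` in the symmetric case the poles move in opposite directions on the two sides of `0`,
so mirror-image terms are paired before comparing. -/

/-- The rational function `∑ i ≤ N, m i / (x - p i)` with poles `p i` and residues `m i`. -/
noncomputable def poleSum (N : ℕ) (m p : ℕ → ℝ) (x : ℝ) : ℝ :=
  ∑ i ∈ Finset.range (N + 1), m i / (x - p i)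

/-- The numerator of `poleSum N m p` over the common denominator `∏ i ≤ N, (X - p i)`. -/
noncomputable def poleNumerator (N : ℕ) (m p : ℕ → ℝ) : ℝ[X] :=
  ∑ i ∈ Finset.range (N + 1), C (m i) * ∏ j ∈ (Finset.range (N + 1)).erase i, (X - C (p j))

/-! ### Zeros of pole sums with positive residues -/

section Poles

variable {N : ℕ} {m m' p p' : ℕ → ℝ}

lemma le_or_le_of_strictMonoOn (hp : StrictMonoOn p (Iic N)) {k i : ℕ} (hk : k < N) (hi : i ≤ N) :
    (i ≤ k ∧ p i ≤ p k) ∨ (k + 1 ≤ i ∧ p (k + 1) ≤ p i) := by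
  rcases Nat.lt_or_ge k i with h | h
  · exact Or.inr ⟨h, hp.monotoneOn (by simp; omega) hi h⟩
  · exact Or.inl ⟨h, hp.monotoneOn hi (by simp; omega) h⟩

lemma sub_ne_zero_of_mem_gap (hp : StrictMonoOn p (Iic N)) {k i : ℕ} (hk : k < N) (hi : i ≤ N)
    {x : ℝ} (hx : x ∈ Ioo (p k) (p (k + 1))) : x - p i ≠ 0 := by
  rcases le_or_le_of_strictMonoOn hp hk hi with ⟨-, h⟩ | ⟨-, h⟩
  · exact (sub_pos.2 (h.trans_lt hx.1)).ne'
  · exact (sub_neg.2 (hx.2.trans_le h)).ne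

lemma poleSum_strictAntiOn (hp : StrictMonoOn p (Iic N)) (hm : ∀ i ≤ N, 0 < m i) {k : ℕ}
    (hk : k < N) : StrictAntiOn (poleSum N m p) (Ioo (p k) (p (k + 1))) := by
  intro x hx y hy hxy
  refine Finset.sum_lt_sum_of_nonempty (by simp) fun i hi => ?_
  have hi : i ≤ N := by simp at hi; omega
  rcases le_or_le_of_strictMonoOn hp hk hi with ⟨-, h⟩ | ⟨-, h⟩
  · exact div_lt_div_of_pos_left (hm i hi) (by linarith [hx.1]) (by linarith)
  · rw [← neg_lt_neg_iff, ← div_neg, ← div_neg]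
    exact div_lt_div_of_pos_left (hm i hi) (by linarith [hy.2]) (by linarith)

lemma eval_poleNumerator_eq_mul_poleSum {x : ℝ} (hx : ∀ i ≤ N, x - p i ≠ 0) :
    (poleNumerator N m p).eval x = (∏ i ∈ Finset.range (N + 1), (x - p i)) * poleSum N m p x := by
  simp only [poleNumerator, poleSum, eval_finsetSum, eval_mul, eval_C, eval_prod, eval_sub, eval_X,
    Finset.mul_sum]
  refine Finset.sum_congr rfl fun i hi => ?_
  have h := hx i (by simp at hi; omega)
  rw [← Finset.mul_prod_erase _ _ hi]
  field_simp

lemma eval_poleNumerator_node {k : ℕ} (hk : k ≤ N) :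
    (poleNumerator N m p).eval (p k) =
      m k * ∏ j ∈ (Finset.range (N + 1)).erase k, (p k - p j) := by
  simp only [poleNumerator, eval_finsetSum, eval_mul, eval_C, eval_prod, eval_sub, eval_X]
  refine Finset.sum_eq_single_of_mem k (by simp; omega) fun i hi hik => ?_
  rw [Finset.prod_eq_zero (i := k) (by simp; omega) (sub_self _), mul_zero]

/-- At a pole only one summand of the numerator survives. At two adjacent poles the surviving
products have opposite signs: the factor joining the two poles flips, and every other pole lies on
the same side of both. Working with the numerator avoids limits at the poles. -/
lemma exists_root_poleNumerator (hp : StrictMonoOn p (Iic N)) (hm : ∀ i ≤ N, 0 < m i) {k : ℕ}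
    (hk : k < N) : ∃ y ∈ Ioo (p k) (p (k + 1)), (poleNumerator N m p).eval y = 0 := by
  have hlt : p k < p (k + 1) := hp (by simp; omega) (by simp; omega) (by omega)
  have hneg : (poleNumerator N m p).eval (p k) * (poleNumerator N m p).eval (p (k + 1)) < 0 := by
    rw [eval_poleNumerator_node hk.le, eval_poleNumerator_node (by omega : k + 1 ≤ N),
      ← Finset.mul_prod_erase _ _ (show k + 1 ∈ (Finset.range (N + 1)).erase k by simp; omega),
      ← Finset.mul_prod_erase ((Finset.range (N + 1)).erase (k + 1)) _
        (show k ∈ (Finset.range (N + 1)).erase (k + 1) by simp; omega),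
      Finset.erase_right_comm (a := k + 1)]
    set s := ((Finset.range (N + 1)).erase k).erase (k + 1) with hs
    have hpos : 0 < (∏ j ∈ s, (p k - p j)) * ∏ j ∈ s, (p (k + 1) - p j) := by
      rw [← Finset.prod_mul_distrib]
      refine Finset.prod_pos fun j hj => ?_
      simp only [hs, Finset.mem_erase, Finset.mem_range] at hj
      rcases Nat.lt_or_ge j k with h | h
      · have h1 : p j < p k := hp (by simp; omega) (by simp; omega) h
        exact mul_pos (by linarith) (by linarith)
      · have h1 : p (k + 1) < p j := hp (by simp; omega) (by simp; omega) (by omega)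
        exact mul_pos_of_neg_of_neg (by linarith) (by linarith)
    have h1 := mul_pos (mul_pos (hm k hk.le) (hm (k + 1) hk)) hpos
    have h2 := mul_pos h1 (mul_pos (sub_pos.2 hlt) (sub_pos.2 hlt))
    linarith
  have hcont : ContinuousOn (fun x => (poleNumerator N m p).eval x) (Icc (p k) (p (k + 1))) :=
    (poleNumerator N m p).continuous.continuousOn
  rcases mul_neg_iff.1 hneg with ⟨h1, h2⟩ | ⟨h1, h2⟩
  · obtain ⟨y, hy, h⟩ := intermediate_value_Ioo' hlt.le hcont ⟨h2, h1⟩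
    exact ⟨y, hy, h⟩
  · obtain ⟨y, hy, h⟩ := intermediate_value_Ioo hlt.le hcont ⟨h1, h2⟩
    exact ⟨y, hy, h⟩

lemma exists_poleSum_eq_zero (hp : StrictMonoOn p (Iic N)) (hm : ∀ i ≤ N, 0 < m i) {k : ℕ}
    (hk : k < N) : ∃ y ∈ Ioo (p k) (p (k + 1)), poleSum N m p y = 0 := by
  obtain ⟨y, hy, h⟩ := exists_root_poleNumerator hp hm hk
  have hne : ∀ i ≤ N, y - p i ≠ 0 := fun i hi => sub_ne_zero_of_mem_gap hp hk hi hy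
  rw [eval_poleNumerator_eq_mul_poleSum hne] at h
  refine ⟨y, hy, (mul_eq_zero.1 h).resolve_left (Finset.prod_ne_zero_iff.2 fun i hi => ?_)⟩
  exact hne i (by simp at hi; omega)

/-- The two sides have the same coefficient of `X ^ N` and agree at the `N` distinct points `y k`,
so their difference, of degree below `N`, vanishes. -/
lemma poleNumerator_eq_prod (hp : StrictMonoOn p (Iic N)) {y : ℕ → ℝ}
    (hy : ∀ k < N, y k ∈ Ioo (p k) (p (k + 1))) (h0 : ∀ k < N, poleSum N m p (y k) = 0) :
    poleNumerator N m p =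
      C (∑ i ∈ Finset.range (N + 1), m i) * ∏ k ∈ Finset.range N, (X - C (y k)) := by
  have hinj : Set.InjOn y (Finset.range N : Finset ℕ) := by
    have key : ∀ i j, i < j → j < N → y i < y j := fun i j hij hj =>
      (hy i (by omega)).2.trans_le
        ((hp.monotoneOn (by simp; omega) (by simp; omega) hij).trans (hy j hj).1.le)
    intro i hi j hj hij
    simp at hi hj
    rcases lt_trichotomy i j with h | h | h
    · exact absurd hij (key i j h hj).ne
    · exact h
    · exact absurd hij (key j i h hi).ne'
  refine Polynomial.eq_of_degree_sub_lt_of_eval_index_eq _ hinj ?_ ?_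
  · have hd : ∀ i ∈ Finset.range (N + 1),
        (∏ j ∈ (Finset.range (N + 1)).erase i, (X - C (p j)) -
          ∏ k ∈ Finset.range N, (X - C (y k))).degree < (N : WithBot ℕ) := by
      intro i hi
      have e1 : (∏ j ∈ (Finset.range (N + 1)).erase i, (X - C (p j))).degree = (N : WithBot ℕ) := by
        rw [degree_prod]; simp [Finset.card_erase_of_mem hi]
      have e2 : (∏ k ∈ Finset.range N, (X - C (y k))).degree = (N : WithBot ℕ) := by
        rw [degree_prod]; simp
      have hmon := monic_prod_X_sub_C p ((Finset.range (N + 1)).erase i)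
      rw [← e1]
      refine degree_sub_lt_left (e1.trans e2.symm) hmon.ne_zero ?_
      rw [hmon.leadingCoeff, (monic_prod_X_sub_C y (Finset.range N)).leadingCoeff]
    rw [poleNumerator, map_sum, Finset.sum_mul, ← Finset.sum_sub_distrib, Finset.card_range]
    refine (degree_sum_le _ _).trans_lt ((Finset.sup_lt_iff ?_).2 fun i hi => ?_)
    · exact WithBot.bot_lt_coe N
    · rw [← mul_sub]
      refine lt_of_le_of_lt ?_ (hd i hi)
      rw [degree_mul]
      exact (add_le_add_left degree_C_le _).trans (by simp)
  · intro k hk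
    have hk' : k < N := by simpa using hk
    rw [eval_poleNumerator_eq_mul_poleSum
      fun i hi => sub_ne_zero_of_mem_gap hp hk' hi (hy k hk'), h0 k hk', mul_zero, eval_mul,
      eval_prod, Finset.prod_eq_zero hk (by simp), mul_zero]

/-- Comparison of the zeros of two pole sums in the gaps with the same index. -/
lemma zero_lt_zero_of_poleSum_lt (hp : StrictMonoOn p (Iic N)) (hm : ∀ i ≤ N, 0 < m i) {k : ℕ}
    (hk : k < N) (hpk : p k ≤ p' k) {y y' : ℝ} (hy : y ∈ Ioo (p k) (p (k + 1)))
    (hy' : y' ∈ Ioo (p' k) (p' (k + 1))) (h0 : poleSum N m p y = 0) (h0' : poleSum N m' p' y' = 0)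
    (hlt : ∀ x ∈ Ioo (p k) (p (k + 1)), x ∈ Ioo (p' k) (p' (k + 1)) →
      poleSum N m p x < poleSum N m' p' x) : y < y' := by
  by_contra! h
  -- If `y' ≤ y`, then `y'` lies in both gaps, and the first sum is nonnegative there by
  -- antitonicity, yet below the second sum, which is zero.
  have hmem : y' ∈ Ioo (p k) (p (k + 1)) := ⟨hpk.trans_lt hy'.1, h.trans_lt hy.2⟩
  have h1 := (poleSum_strictAntiOn hp hm hk).antitoneOn hmem hy h
  have h2 := hlt y' hmem hy'
  linarith

/-- A pole moving right without crossing `x` raises its term at `x`. -/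
lemma div_sub_le_div_sub {M x q q' : ℝ} (hM : 0 ≤ M) (hq : q ≤ q')
    (h : q' < x ∨ x < q) : M / (x - q) ≤ M / (x - q') := by
  rcases h with h | h
  · exact div_le_div_of_nonneg_left hM (by linarith) (by linarith)
  · rw [← neg_le_neg_iff, ← div_neg, ← div_neg]
    exact div_le_div_of_nonneg_left hM (by linarith) (by linarith)

end Poles

/-! ### The poles and residues of the recursion -/

/-- The poles of the pole sum whose zeros are the zeros of the polynomial of index `n + 1`, in
terms of the zeros `z` of the polynomial of index `n`. -/
noncomputable def node (n : ℕ) (a : ℝ) (z : ℕ → ℝ) (i : ℕ) : ℝ :=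
  if i = 0 then a else if i ≤ n then z (i - 1) else if i = n + 1 then 0
    else if i ≤ 2 * n + 1 then z (i - 2) else 1

/-- The residues at the poles `node n a z`. -/
noncomputable def nodeWeight (n : ℕ) (A B C : ℝ) (i : ℕ) : ℝ :=
  if i = 0 then A else if i = n + 1 then B else if i = 2 * n + 2 then C else 1

section Node

variable {n : ℕ} {a A B C' : ℝ} {z z' : ℕ → ℝ}

@[simp] lemma node_zero : node n a z 0 = a := by simp [node]

@[simp] lemma node_mid : node n a z (n + 1) = 0 := by simp [node]

@[simp] lemma node_last : node n a z (2 * n + 2) = 1 := by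
  have h1 : ¬ 2 * n + 2 ≤ n := by omega
  have h2 : ¬ 2 * n + 2 = n + 1 := by omega
  simp [node, h1, h2]

lemma node_left {i : ℕ} (hi : i < n) : node n a z (i + 1) = z i := by
  simp [node, Nat.succ_le_of_lt hi]

lemma node_right {i : ℕ} (hi : n ≤ i) (hi' : i < 2 * n) : node n a z (i + 2) = z i := by
  have h1 : ¬ i + 2 ≤ n := by omega
  have h2 : ¬ i + 2 = n + 1 := by omega
  have h3 : i + 2 ≤ 2 * n + 1 := by omega
  simp [node, h1, h2, h3]

lemma node_cases {i : ℕ} (hi : i ≤ 2 * n + 2) :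
    i = 0 ∨ (∃ j < n, i = j + 1) ∨ i = n + 1 ∨ (∃ j, n ≤ j ∧ j < 2 * n ∧ i = j + 2) ∨
      i = 2 * n + 2 := by
  by_cases h0 : i = 0
  · exact Or.inl h0
  by_cases h1 : i ≤ n
  · exact Or.inr (Or.inl ⟨i - 1, by omega, by omega⟩)
  by_cases h2 : i = n + 1
  · exact Or.inr (Or.inr (Or.inl h2))
  by_cases h3 : i = 2 * n + 2
  · exact Or.inr (Or.inr (Or.inr (Or.inr h3)))
  · exact Or.inr (Or.inr (Or.inr (Or.inl ⟨i - 2, by omega, by omega, by omega⟩)))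

@[simp] lemma nodeWeight_zero : nodeWeight n A B C' 0 = A := by simp [nodeWeight]

@[simp] lemma nodeWeight_mid : nodeWeight n A B C' (n + 1) = B := by simp [nodeWeight]

@[simp] lemma nodeWeight_last : nodeWeight n A B C' (2 * n + 2) = C' := by
  have h2 : ¬ 2 * n + 2 = n + 1 := by omega
  simp [nodeWeight, h2]

lemma nodeWeight_of_ne {i : ℕ} (h0 : i ≠ 0) (h1 : i ≠ n + 1) (h2 : i ≠ 2 * n + 2) :
    nodeWeight n A B C' i = 1 := by
  simp [nodeWeight, h0, h1, h2]

lemma nodeWeight_pos (hA : 0 < A) (hB : 0 < B) (hC : 0 < C') (i : ℕ) :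
    0 < nodeWeight n A B C' i := by
  unfold nodeWeight; split_ifs <;> first | assumption | norm_num

lemma sum_nodeWeight_pos (hA : 0 < A) (hB : 0 < B) (hC : 0 < C') :
    0 < ∑ i ∈ Finset.range (2 * n + 2 + 1), nodeWeight n A B C' i :=
  Finset.sum_pos (fun i _ => nodeWeight_pos hA hB hC i) (by simp)

lemma node_le_node (h : ∀ i < 2 * n, z i ≤ z' i) {i : ℕ} (hi : i ≤ 2 * n + 2) :
    node n a z i ≤ node n a z' i := by
  rcases node_cases hi with rfl | ⟨j, hj, rfl⟩ | rfl | ⟨j, hj, hj', rfl⟩ | rfl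
  · simp
  · rw [node_left hj, node_left hj]; exact h j (by omega)
  · simp
  · rw [node_right hj hj', node_right hj hj']; exact h j hj'
  · simp

lemma prod_X_sub_C_node :
    ∏ i ∈ Finset.range (2 * n + 2 + 1), (X - C (node n a z i)) =
      (X - C a) * X * (X - C 1) * ∏ i ∈ Finset.range (2 * n), (X - C (z i)) := by
  have e : 2 * n + 2 = n + 1 + (n + 1) := by ring
  rw [Finset.prod_range_succ, node_last, e, Finset.prod_range_add, Finset.prod_range_succ',
    Finset.prod_range_succ', two_mul, Finset.prod_range_add, node_zero, add_zero, node_mid]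
  have h1 : ∏ k ∈ Finset.range n, (X - C (node n a z (k + 1))) =
      ∏ k ∈ Finset.range n, (X - C (z k)) :=
    Finset.prod_congr rfl fun i hi => by rw [node_left (by simpa using hi)]
  have h2 : ∏ k ∈ Finset.range n, (X - C (node n a z (n + 1 + (k + 1)))) =
      ∏ k ∈ Finset.range n, (X - C (z (n + k))) :=
    Finset.prod_congr rfl fun i hi => by
      have : i < n := by simpa using hi
      rw [show n + 1 + (i + 1) = n + i + 2 by ring, node_right (by omega) (by omega)]
  rw [h1, h2, map_zero]
  ring

/-- This identifies the numerator with the output of the raising operator. With unit residues the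
numerator is the derivative of the product over all nodes; only the residues at `a`, `0` and `1`
need a correction. -/
lemma poleNumerator_node :
    poleNumerator (2 * n + 2) (nodeWeight n A B C') (node n a z) =
      (X - C a) * X * (X - C 1) * derivative (∏ i ∈ Finset.range (2 * n), (X - C (z i))) +
      (C A * (X * (X - C 1)) + C B * ((X - C a) * (X - C 1)) + C C' * ((X - C a) * X)) *
        ∏ i ∈ Finset.range (2 * n), (X - C (z i)) := by
  set P : ℝ[X] := ∏ i ∈ Finset.range (2 * n), (X - C (z i)) with hP
  set s := Finset.range (2 * n + 2 + 1) with hs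
  set E : ℕ → ℝ[X] := fun i => ∏ j ∈ s.erase i, (X - C (node n a z j)) with hE
  have hEi : ∀ i ∈ s, (X - C (node n a z i)) * E i = (X - C a) * X * (X - C 1) * P := fun i hi => by
    rw [hE, Finset.mul_prod_erase s (fun j => X - C (node n a z j)) hi, hs, prod_X_sub_C_node]
  have h0 : E 0 = X * (X - C 1) * P := by
    refine mul_left_cancel₀ (X_sub_C_ne_zero a) ?_
    have := hEi 0 (by simp [hs])
    rw [node_zero] at this
    rw [this]; ring
  have h1 : E (n + 1) = (X - C a) * (X - C 1) * P := by
    refine mul_left_cancel₀ X_ne_zero ?_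
    have := hEi (n + 1) (by simp [hs]; omega)
    rw [node_mid, map_zero, sub_zero] at this
    rw [this]; ring
  have h2 : E (2 * n + 2) = (X - C a) * X * P := by
    refine mul_left_cancel₀ (X_sub_C_ne_zero 1) ?_
    have := hEi (2 * n + 2) (by simp [hs])
    rw [node_last] at this
    rw [this]; ring
  have hd : ∑ i ∈ s, E i = derivative ((X - C a) * X * (X - C 1) * P) := by
    rw [← prod_X_sub_C_node, derivative_prod_finset]
    exact Finset.sum_congr rfl fun i _ => by simp [hE, hs]
  have hdiff : ∑ i ∈ s, C (nodeWeight n A B C' i - 1) * E i =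
      C (A - 1) * E 0 + C (B - 1) * E (n + 1) + C (C' - 1) * E (2 * n + 2) := by
    have hsub : ({0, n + 1, 2 * n + 2} : Finset ℕ) ⊆ s := by
      intro i hi; simp at hi; simp [hs]; omega
    rw [← Finset.sum_subset hsub, Finset.sum_insert (by simp), Finset.sum_insert (by simp; omega),
      Finset.sum_singleton, nodeWeight_zero, nodeWeight_mid, nodeWeight_last, add_assoc]
    intro i _ hi
    simp at hi
    rw [nodeWeight_of_ne hi.1 hi.2.1 hi.2.2]; simp
  have : poleNumerator (2 * n + 2) (nodeWeight n A B C') (node n a z) =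
      ∑ i ∈ s, C (nodeWeight n A B C' i - 1) * E i + ∑ i ∈ s, E i := by
    rw [← Finset.sum_add_distrib, poleNumerator]
    exact Finset.sum_congr rfl fun i _ => by simp [hE, hs]; ring
  rw [this, hdiff, hd, h0, h1, h2]
  simp only [derivative_mul, derivative_X, derivative_C, map_sub, map_one, derivative_one]
  ring

end Node

/-! ### Recursively defined zeros and their interlacing -/

/-- `z 0, …, z (2 * n - 1)` are obtained from the empty sequence by `n` times passing from the
sequence to the zeros of the associated pole sum. -/
def IsZeroSeq (a : ℝ) : ℕ → ℝ → ℝ → ℝ → (ℕ → ℝ) → Prop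
  | 0, _, _, _, _ => True
  | n + 1, α, β, γ, y => ∃ z, IsZeroSeq a n (α + 1) (β + 1) (γ + 1) z ∧ ∀ k < 2 * n + 2,
      y k ∈ Ioo (node n a z k) (node n a z (k + 1)) ∧
      poleSum (2 * n + 2) (nodeWeight n (α + 1) (β + 1) (γ + 1)) (node n a z) (y k) = 0

namespace IsZeroSeq

variable {n : ℕ} {a α β γ : ℝ} {z z' : ℕ → ℝ}

/-- The nodes of the previous level separate the `z k`. Exactly half of the gaps lie to the left of
the node `0`, so inserting `0` in the middle of the `z k` keeps the order. -/
lemma node_strictMonoOn (ha : a < 0) (h : IsZeroSeq a n α β γ z) :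
    StrictMonoOn (node n a z) (Iic (2 * n + 2)) := by
  refine strictMonoOn_Iic_of_lt_succ fun i hi => ?_
  rw [Order.succ_eq_add_one]
  cases n with
  | zero =>
    have : i = 0 ∨ i = 1 := by omega
    rcases this with rfl | rfl <;> simp [node, ha]
  | succ n =>
    obtain ⟨w, -, hw⟩ := h
    have hw1 : ∀ k < 2 * n + 2, node n a w k < z k := fun k hk => (hw k hk).1.1
    have hw2 : ∀ k < 2 * n + 2, z k < node n a w (k + 1) := fun k hk => (hw k hk).1.2
    rcases node_cases hi.le with rfl | ⟨j, hj, rfl⟩ | rfl | ⟨j, hj, hj', rfl⟩ | rfl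
    · rw [node_zero, node_left (by omega)]
      simpa using hw1 0 (by omega)
    · rw [node_left hj]
      have h1 := hw2 j (by omega)
      by_cases hjn : j = n
      · subst hjn
        rw [node_mid] at h1 ⊢
        exact h1
      · rw [node_left (by omega)]
        exact h1.trans (hw1 (j + 1) (by omega))
    · rw [node_mid, show n + 1 + 1 + 1 = n + 1 + 2 by ring, node_right le_rfl (by omega)]
      simpa using hw1 (n + 1) (by omega)
    · rw [node_right hj hj']
      have h1 := hw2 j (by omega)
      by_cases hjn : j = 2 * n + 1
      · subst hjn
        rw [node_last] at h1
        rw [show 2 * n + 1 + 2 + 1 = 2 * (n + 1) + 2 by ring, node_last]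
        exact h1
      · rw [show j + 2 + 1 = j + 1 + 2 by ring, node_right (by omega) (by omega)]
        exact h1.trans (hw1 (j + 1) (by omega))
    · omega

lemma lt_of_lt (ha : a < 0) (h : IsZeroSeq a n α β γ z) {i j : ℕ} (hij : i < j) (hj : j < 2 * n) :
    z i < z j := by
  have hm := h.node_strictMonoOn ha
  have key : ∀ i < 2 * n, ∃ k, (k = if i < n then i + 1 else i + 2) ∧ node n a z k = z i := by
    intro i hi
    by_cases hin : i < n
    · exact ⟨i + 1, by simp [hin], node_left hin⟩
    · exact ⟨i + 2, by simp [hin], node_right (by omega) hi⟩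
  obtain ⟨k, hk, hki⟩ := key i (by omega)
  obtain ⟨l, hl, hlj⟩ := key j hj
  rw [← hki, ← hlj]
  refine hm ?_ ?_ ?_
  · simp; split_ifs at hk <;> omega
  · simp; split_ifs at hl <;> omega
  · split_ifs at hk hl <;> omega

lemma mem_Ioo_left (ha : a < 0) (h : IsZeroSeq a n α β γ z) {i : ℕ} (hi : i < n) :
    z i ∈ Ioo a 0 := by
  have hm := h.node_strictMonoOn ha
  have h1 := @hm 0 (by simp) (i + 1) (by simp; omega) (by omega)
  have h2 := @hm (i + 1) (by simp; omega) (n + 1) (by simp; omega) (by omega)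
  rw [node_left hi] at h1 h2
  exact ⟨by simpa using h1, by simpa using h2⟩

lemma mem_Ioo_right (ha : a < 0) (h : IsZeroSeq a n α β γ z) {i : ℕ} (hi : n ≤ i)
    (hi' : i < 2 * n) : z i ∈ Ioo 0 1 := by
  have hm := h.node_strictMonoOn ha
  have h1 := @hm (n + 1) (by simp; omega) (i + 2) (by simp; omega) (by omega)
  have h2 := @hm (i + 2) (by simp; omega) (2 * n + 2) (by simp) (by omega)
  rw [node_right hi hi'] at h1 h2
  exact ⟨by simpa using h1, by simpa using h2⟩

end IsZeroSeq

lemma exists_isZeroSeq {a : ℝ} (ha : a < 0) (n : ℕ) : ∀ {α β γ : ℝ}, -1 < α → -1 < β → -1 < γ →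
    ∃ z, IsZeroSeq a n α β γ z := by
  induction n with
  | zero => exact fun _ _ _ => ⟨0, trivial⟩
  | succ n ih =>
    intro α β γ hα hβ hγ
    obtain ⟨z, hz⟩ := ih (α := α + 1) (β := β + 1) (γ := γ + 1)
      (by linarith) (by linarith) (by linarith)
    have h : ∀ k, ∃ y, k < 2 * n + 2 → y ∈ Ioo (node n a z k) (node n a z (k + 1)) ∧
        poleSum (2 * n + 2) (nodeWeight n (α + 1) (β + 1) (γ + 1)) (node n a z) y = 0 := by
      intro k
      by_cases hk : k < 2 * n + 2
      · obtain ⟨y, hy, hy0⟩ := exists_poleSum_eq_zero (hz.node_strictMonoOn ha)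
          (fun i _ => nodeWeight_pos (by linarith : 0 < α + 1) (by linarith : 0 < β + 1)
            (by linarith : 0 < γ + 1) i) hk
        exact ⟨y, fun _ => ⟨hy, hy0⟩⟩
      · exact ⟨0, fun h => absurd h hk⟩
    choose y hy using h
    exact ⟨y, z, hz, hy⟩

/-! ### Monotonicity in `α` and `γ` -/

/-- The sign condition under which both poles lie on the same side of a point of a common gap. -/
lemma side_of_mem_gaps {N k i : ℕ} {p p' : ℕ → ℝ} (hp : StrictMonoOn p (Iic N))
    (hp' : StrictMonoOn p' (Iic N)) (hk : k < N) (hi : i ≤ N) {x : ℝ}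
    (hx : x ∈ Ioo (p k) (p (k + 1))) (hx' : x ∈ Ioo (p' k) (p' (k + 1))) :
    (i ≤ k ∧ p i < x ∧ p' i < x) ∨ (k < i ∧ x < p i ∧ x < p' i) := by
  rcases le_or_le_of_strictMonoOn hp hk hi with ⟨h1, h⟩ | ⟨h1, h⟩ <;>
  rcases le_or_le_of_strictMonoOn hp' hk hi with ⟨h1', h'⟩ | ⟨h1', h'⟩
  · exact Or.inl ⟨h1, h.trans_lt hx.1, h'.trans_lt hx'.1⟩
  · omega
  · omega
  · exact Or.inr ⟨h1, hx.2.trans_le h, hx'.2.trans_le h'⟩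

/-- Since `a < x < 1`, raising `α` and lowering `γ` both raise the pole sum, so one induction serves
both parameters. The moving poles contribute weakly; strictness comes from the residue at `a` or at
`1`. -/
lemma IsZeroSeq.lt_of_alpha_le_of_gamma_le {a : ℝ} (ha : a < 0) (n : ℕ) :
    ∀ {α α' β γ γ' : ℝ} {z z' : ℕ → ℝ}, -1 < α → -1 < β → -1 < γ' → α ≤ α' → γ' ≤ γ →
    (α < α' ∨ γ' < γ) → IsZeroSeq a n α β γ z → IsZeroSeq a n α' β γ' z' →
    ∀ j < 2 * n, z j < z' j := by
  induction n with
  | zero => intros; omega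
  | succ n ih =>
    intro α α' β γ γ' y y' hα hβ hγ hαα hγγ hlt ⟨z, hz, hy⟩ ⟨z', hz', hy'⟩ k hk
    have hzz := ih (by linarith) (by linarith) (by linarith) (by linarith) (by linarith)
      (hlt.imp (by intro; linarith) (by intro; linarith)) hz hz'
    have hp := hz.node_strictMonoOn ha
    have hp' := hz'.node_strictMonoOn ha
    have hle : ∀ i ≤ 2 * n + 2, node n a z i ≤ node n a z' i :=
      fun i hi => node_le_node (fun i hi => (hzz i hi).le) hi
    refine zero_lt_zero_of_poleSum_lt hp
      (fun i _ => nodeWeight_pos (by linarith) (by linarith) (by linarith) i)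
      hk (hle k (by omega)) (hy k hk).1 (hy' k hk).1 (hy k hk).2 (hy' k hk).2 fun x hx hx' => ?_
    have hxa : a < x := by
      have := side_of_mem_gaps hp hp' hk (Nat.zero_le _) hx hx'
      simp at this; exact this
    have hx1 : x < 1 := by
      have := side_of_mem_gaps hp hp' hk le_rfl hx hx'
      simp only [node_last] at this
      rcases this with h | h
      · omega
      · exact h.2.1
    have h1 : ∀ i ∈ Finset.range (2 * n + 2 + 1),
        nodeWeight n (α + 1) (β + 1) (γ + 1) i / (x - node n a z i) ≤
        nodeWeight n (α' + 1) (β + 1) (γ' + 1) i / (x - node n a z' i) := by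
      intro i hi
      have hi : i ≤ 2 * n + 2 := by simp at hi; omega
      by_cases h0 : i = 0
      · subst h0
        simp only [node_zero, nodeWeight_zero]
        exact div_le_div_of_nonneg_right (by linarith) (by linarith)
      by_cases h2 : i = 2 * n + 2
      · subst h2
        simp only [node_last, nodeWeight_last]
        exact div_le_div_of_nonpos_of_le (by linarith) (by linarith)
      have hw : nodeWeight n (α' + 1) (β + 1) (γ' + 1) i =
          nodeWeight n (α + 1) (β + 1) (γ + 1) i := by simp [nodeWeight, h0, h2]
      rw [hw]
      refine div_sub_le_div_sub (nodeWeight_pos (by linarith) (by linarith) (by linarith) i).le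
        (hle i hi) ?_
      rcases side_of_mem_gaps hp hp' hk hi hx hx' with h | h
      · exact Or.inl h.2.2
      · exact Or.inr h.2.1
    refine Finset.sum_lt_sum h1 ?_
    rcases hlt with h | h
    · refine ⟨0, by simp, ?_⟩
      simp only [node_zero, nodeWeight_zero]
      exact div_lt_div_of_pos_right (by linarith) (by linarith)
    · refine ⟨2 * n + 2, by simp, ?_⟩
      simp only [node_last, nodeWeight_last]
      exact div_lt_div_of_neg_of_lt (by linarith) (by linarith)

/-! ### The symmetric case and monotonicity in `β` -/

section Symmetric

lemma node_symm {n : ℕ} {z : ℕ → ℝ} (h : ∀ i < 2 * n, z (2 * n - 1 - i) = -z i) {i : ℕ}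
    (hi : i ≤ 2 * n + 2) : node n (-1) z (2 * n + 2 - i) = -node n (-1) z i := by
  rcases node_cases hi with rfl | ⟨j, hj, rfl⟩ | rfl | ⟨j, hj, hj', rfl⟩ | rfl
  · simp
  · rw [node_left hj, ← h j (by omega), show 2 * n + 2 - (j + 1) = 2 * n - 1 - j + 2 by omega,
      node_right (by omega) (by omega)]
  · rw [show 2 * n + 2 - (n + 1) = n + 1 by omega]; simp
  · rw [node_right hj hj', ← h j (by omega), show 2 * n + 2 - (j + 2) = 2 * n - 1 - j + 1 by omega,
      node_left (by omega)]
  · simp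

lemma nodeWeight_symm {n : ℕ} {A B : ℝ} {i : ℕ} (hi : i ≤ 2 * n + 2) :
    nodeWeight n A B A (2 * n + 2 - i) = nodeWeight n A B A i := by
  unfold nodeWeight
  split_ifs <;> first | rfl | omega

lemma poleSum_eq_sum_reflect {n : ℕ} {A B : ℝ} {z : ℕ → ℝ}
    (h : ∀ i < 2 * n, z (2 * n - 1 - i) = -z i) (x : ℝ) :
    poleSum (2 * n + 2) (nodeWeight n A B A) (node n (-1) z) x =
      ∑ i ∈ Finset.range (2 * n + 2 + 1), nodeWeight n A B A i / (x + node n (-1) z i) := by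
  rw [poleSum, ← Finset.sum_range_reflect]
  refine Finset.sum_congr rfl fun i hi => ?_
  have hi : i ≤ 2 * n + 2 := by simp at hi; omega
  rw [show 2 * n + 2 + 1 - 1 - i = 2 * n + 2 - i by omega, node_symm h hi, nodeWeight_symm hi,
    sub_neg_eq_add]

/-- By induction the poles and residues are symmetric, so the pole sum is odd and `-y i` is a zero
in the mirrored gap, where the zero is unique. -/
lemma IsZeroSeq.symm (n : ℕ) : ∀ {α β : ℝ} {z : ℕ → ℝ}, -1 < α → -1 < β →
    IsZeroSeq (-1) n α β α z → ∀ i < 2 * n, z (2 * n - 1 - i) = -z i := by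
  induction n with
  | zero => intros; omega
  | succ n ih =>
    intro α β y hα hβ ⟨z, hz, hy⟩ i hi
    have hs := ih (by linarith) (by linarith) hz
    have hp := hz.node_strictMonoOn (by norm_num)
    have hi' : 2 * (n + 1) - 1 - i < 2 * n + 2 := by omega
    obtain ⟨h1, h2⟩ := hy _ hi'
    obtain ⟨h3, h4⟩ := hy i hi
    have hmem : -y i ∈ Ioo (node n (-1) z (2 * (n + 1) - 1 - i))
        (node n (-1) z (2 * (n + 1) - 1 - i + 1)) := by
      rw [show 2 * (n + 1) - 1 - i = 2 * n + 2 - (i + 1) by omega, node_symm hs (by omega),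
        show 2 * n + 2 - (i + 1) + 1 = 2 * n + 2 - i by omega, node_symm hs (by omega)]
      exact ⟨neg_lt_neg h3.2, neg_lt_neg h3.1⟩
    have hanti := poleSum_strictAntiOn hp (m := nodeWeight n (α + 1) (β + 1) (α + 1))
      (fun i _ => nodeWeight_pos (by linarith) (by linarith) (by linarith) i) hi'
    refine hanti.injOn h1 hmem ?_
    rw [h2, poleSum_eq_sum_reflect hs, ← neg_eq_zero.2 h4, poleSum, ← Finset.sum_neg_distrib]
    refine Finset.sum_congr rfl fun i _ => ?_
    rw [← div_neg]; congr 1; ring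

/-- The paired terms add up to `2xM / (x² - q²)`, a single pole in the variable `x²` which moves
right from `q²` to `q'²`. -/
lemma div_sub_add_div_add_le {M x q q' : ℝ} (hM : 0 ≤ M) (hx : 0 < x) (hq0 : 0 ≤ q) (hq : q ≤ q')
    (h : q' < x ∨ x < q) :
    M / (x - q) + M / (x + q) ≤ M / (x - q') + M / (x + q') := by
  have e : ∀ r, x - r ≠ 0 → x + r ≠ 0 →
      M / (x - r) + M / (x + r) = 2 * x * M / (x ^ 2 - r ^ 2) := by
    intro r h1 h2
    rw [show x ^ 2 - r ^ 2 = (x - r) * (x + r) by ring]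
    field_simp; ring
  have h2 : q ^ 2 ≤ q' ^ 2 := by nlinarith
  rw [e q (by rcases h with h | h <;> intro h' <;> linarith) (by linarith),
    e q' (by rcases h with h | h <;> intro h' <;> linarith) (by linarith)]
  refine div_sub_le_div_sub (by positivity) h2 ?_
  rcases h with h | h
  · left; nlinarith
  · right; nlinarith

/-- Single terms are not monotone, since the negative poles move left. Twice the pole sum, written
as the sum plus its reflection, is compared term by term; strictness comes from the residue at `0`.
-/
lemma IsZeroSeq.lt_of_beta_lt (n : ℕ) :
    ∀ {α β β' : ℝ} {z z' : ℕ → ℝ}, -1 < α → -1 < β → β < β' → IsZeroSeq (-1) n α β α z →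
    IsZeroSeq (-1) n α β' α z' → ∀ j < 2 * n, n ≤ j → z j < z' j := by
  induction n with
  | zero => intros; omega
  | succ n ih =>
    intro α β β' y y' hα hβ hlt ⟨z, hz, hy⟩ ⟨z', hz', hy'⟩ k hk hnk
    have hzz := ih (by linarith) (by linarith) (by linarith) hz hz'
    have hs := hz.symm n (by linarith) (by linarith)
    have hs' := hz'.symm n (by linarith) (by linarith)
    have hp := hz.node_strictMonoOn (by norm_num)
    have hp' := hz'.node_strictMonoOn (by norm_num)
    have hle : ∀ i ≤ 2 * n + 2, n + 1 ≤ i → node n (-1) z i ≤ node n (-1) z' i := by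
      intro i hi hni
      rcases node_cases hi with rfl | ⟨j, hj, rfl⟩ | rfl | ⟨j, hj, hj', rfl⟩ | rfl
      · omega
      · omega
      · simp
      · rw [node_right hj hj', node_right hj hj']; exact (hzz j hj' hj).le
      · simp
    refine zero_lt_zero_of_poleSum_lt hp
      (fun i _ => nodeWeight_pos (by linarith) (by linarith) (by linarith) i)
      hk (hle k (by omega) hnk) (hy k hk).1 (hy' k hk).1 (hy k hk).2 (hy' k hk).2 fun x hx hx' => ?_
    have hx0 : 0 < x := by
      have := side_of_mem_gaps hp hp' hk (show n + 1 ≤ 2 * n + 2 by omega) hx hx'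
      rw [node_mid] at this
      rcases this with h | h
      · exact h.2.1
      · omega
    have key : ∀ i ≤ 2 * n + 2, n + 1 < i →
        nodeWeight n (α + 1) (β + 1) (α + 1) i / (x - node n (-1) z i) +
        nodeWeight n (α + 1) (β + 1) (α + 1) i / (x + node n (-1) z i) ≤
        nodeWeight n (α + 1) (β' + 1) (α + 1) i / (x - node n (-1) z' i) +
        nodeWeight n (α + 1) (β' + 1) (α + 1) i / (x + node n (-1) z' i) := by
      intro i hi hni
      have hw : nodeWeight n (α + 1) (β' + 1) (α + 1) i =
          nodeWeight n (α + 1) (β + 1) (α + 1) i := by simp [nodeWeight, hni.ne']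
      rw [hw]
      have h0 : 0 ≤ node n (-1) z i := by
        have := hp.monotoneOn (show n + 1 ≤ 2 * n + 2 by omega) hi hni.le
        simpa using this
      refine div_sub_add_div_add_le (nodeWeight_pos (by linarith) (by linarith) (by linarith) i).le
        hx0 h0 (hle i hi hni.le) ?_
      rcases side_of_mem_gaps hp hp' hk hi hx hx' with h | h
      · exact Or.inl h.2.2
      · exact Or.inr h.2.1
    have hmid : nodeWeight n (α + 1) (β + 1) (α + 1) (n + 1) / (x - node n (-1) z (n + 1)) +
        nodeWeight n (α + 1) (β + 1) (α + 1) (n + 1) / (x + node n (-1) z (n + 1)) <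
        nodeWeight n (α + 1) (β' + 1) (α + 1) (n + 1) / (x - node n (-1) z' (n + 1)) +
        nodeWeight n (α + 1) (β' + 1) (α + 1) (n + 1) / (x + node n (-1) z' (n + 1)) := by
      simp only [node_mid, nodeWeight_mid, sub_zero, add_zero]
      have : (β + 1) / x < (β' + 1) / x := div_lt_div_of_pos_right (by linarith) hx0
      linarith
    have hsum : poleSum (2 * n + 2) (nodeWeight n (α + 1) (β + 1) (α + 1)) (node n (-1) z) x +
        poleSum (2 * n + 2) (nodeWeight n (α + 1) (β + 1) (α + 1)) (node n (-1) z) x <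
        poleSum (2 * n + 2) (nodeWeight n (α + 1) (β' + 1) (α + 1)) (node n (-1) z') x +
        poleSum (2 * n + 2) (nodeWeight n (α + 1) (β' + 1) (α + 1)) (node n (-1) z') x := by
      conv_lhs => rw [poleSum_eq_sum_reflect hs, ← poleSum_eq_sum_reflect hs]
      conv_lhs => arg 2; rw [poleSum_eq_sum_reflect hs]
      conv_rhs => arg 2; rw [poleSum_eq_sum_reflect hs']
      rw [poleSum, poleSum, ← Finset.sum_add_distrib, ← Finset.sum_add_distrib]
      refine Finset.sum_lt_sum (fun i hi => ?_) ⟨n + 1, by simp; omega, hmid⟩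
      have hi : i ≤ 2 * n + 2 := by simp at hi; omega
      rcases lt_trichotomy i (n + 1) with h | rfl | h
      -- Left of the middle, the pair is that of the mirrored index with its two summands exchanged.
      · have := key (2 * n + 2 - i) (by omega) (by omega)
        rw [node_symm hs hi, node_symm hs' hi, nodeWeight_symm hi, nodeWeight_symm hi] at this
        simp only [sub_neg_eq_add, ← sub_eq_add_neg] at this
        linarith
      · exact hmid.le
      · exact key i hi h
    linarith

end Symmetric

/-! ### The weight, the raising operator and root counting -/

section Weight

open MeasureTheory

/-- The Jacobi-Angelesco weight, with `|x|` on both intervals of orthogonality. -/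
noncomputable def angelescoWeight (a α β γ x : ℝ) : ℝ := (x - a) ^ α * |x| ^ β * (1 - x) ^ γ

/-- `(u, v)` is one of the two intervals of orthogonality and `s` is the sign of its points. -/
def IsAngelescoInterval (a u v s : ℝ) : Prop := (u = a ∧ v = 0 ∧ s = -1) ∨ (u = 0 ∧ v = 1 ∧ s = 1)

variable {a α β γ u v s : ℝ}

namespace IsAngelescoInterval

lemma lt (h : IsAngelescoInterval a u v s) (ha : a < 0) : u < v := by
  rcases h with ⟨rfl, rfl, -⟩ | ⟨rfl, rfl, -⟩
  · exact ha
  · exact one_pos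

lemma mul_self (h : IsAngelescoInterval a u v s) : s * s = 1 := by
  rcases h with ⟨-, -, rfl⟩ | ⟨-, -, rfl⟩ <;> norm_num

lemma bounds (h : IsAngelescoInterval a u v s) (ha : a < 0) {x : ℝ} (hx : x ∈ Ioo u v) :
    a < x ∧ x < 1 ∧ x ≠ 0 ∧ |x| = s * x := by
  rcases h with ⟨rfl, rfl, rfl⟩ | ⟨rfl, rfl, rfl⟩
  · exact ⟨hx.1, by linarith [hx.2], hx.2.ne, by rw [abs_of_neg hx.2]; ring⟩
  · exact ⟨by linarith [hx.1], hx.2, hx.1.ne', by rw [abs_of_pos hx.1]; ring⟩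

end IsAngelescoInterval

/-- Cutting at the midpoint leaves one endpoint singularity on each half, the other factor being
continuous there. -/
lemma intervalIntegrable_rpow_mul_rpow {p q : ℝ} (huv : u < v) (hp : -1 < p) (hq : -1 < q) :
    IntervalIntegrable (fun x => (x - u) ^ p * (v - x) ^ q) volume u v := by
  set c := (u + v) / 2 with hc
  have h1 : IntervalIntegrable (fun x => (x - u) ^ p) volume u c := by
    simpa using (intervalIntegral.intervalIntegrable_rpow' (a := 0) (b := c - u) hp).comp_sub_right u
  have h2 : IntervalIntegrable (fun x => (v - x) ^ q) volume c v := by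
    simpa using (intervalIntegral.intervalIntegrable_rpow' (a := v - c) (b := 0) hq).comp_sub_left v
  refine IntervalIntegrable.trans (b := c) (h1.mul_continuousOn ?_) (h2.continuousOn_mul ?_)
  · rw [uIcc_of_le (by linarith)]
    refine ContinuousOn.rpow_const (by fun_prop) fun x hx => Or.inl ?_
    linarith [hx.2]
  · rw [uIcc_of_le (by linarith)]
    refine ContinuousOn.rpow_const (by fun_prop) fun x hx => Or.inl ?_
    linarith [hx.1]

lemma IsAngelescoInterval.intervalIntegrable (h : IsAngelescoInterval a u v s) (ha : a < 0)
    (hα : -1 < α) (hβ : -1 < β) (hγ : -1 < γ) {f : ℝ → ℝ} (hf : Continuous f) :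
    IntervalIntegrable (fun x => f x * angelescoWeight a α β γ x) volume u v := by
  rcases h with ⟨rfl, rfl, -⟩ | ⟨rfl, rfl, -⟩
  · refine ((intervalIntegrable_rpow_mul_rpow ha hα hβ).mul_continuousOn
      (g := fun x => f x * (1 - x) ^ γ) ?_).congr fun x hx => ?_
    · rw [uIcc_of_le ha.le]
      refine hf.continuousOn.mul (ContinuousOn.rpow_const (by fun_prop) fun x hx => Or.inl ?_)
      linarith [hx.2]
    · rw [uIoc_of_le ha.le] at hx
      simp only [angelescoWeight, abs_of_nonpos hx.2, zero_sub]
      ring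
  · refine ((intervalIntegrable_rpow_mul_rpow one_pos hβ hγ).mul_continuousOn
      (g := fun x => f x * (x - a) ^ α) ?_).congr fun x hx => ?_
    · rw [uIcc_of_le zero_le_one]
      refine hf.continuousOn.mul (ContinuousOn.rpow_const (by fun_prop) fun x hx => Or.inl ?_)
      linarith [hx.1]
    · rw [uIoc_of_le zero_le_one] at hx
      simp only [angelescoWeight, abs_of_pos hx.1, sub_zero]
      ring

lemma angelescoWeight_pos (ha : a < u) (h0 : u ≠ 0) (h1 : u < 1) :
    0 < angelescoWeight a α β γ u :=
  mul_pos (mul_pos (Real.rpow_pos_of_pos (by linarith) _) (Real.rpow_pos_of_pos (by simpa) _))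
    (Real.rpow_pos_of_pos (by linarith) _)

lemma continuous_angelescoWeight (hα : 0 ≤ α) (hβ : 0 ≤ β) (hγ : 0 ≤ γ) :
    Continuous (angelescoWeight a α β γ) := by
  have h1 : Continuous fun x : ℝ => (x - a) ^ α :=
    Continuous.rpow_const (by fun_prop) fun _ => Or.inr hα
  have h2 : Continuous fun x : ℝ => |x| ^ β :=
    Continuous.rpow_const (by fun_prop) fun _ => Or.inr hβ
  have h3 : Continuous fun x : ℝ => (1 - x) ^ γ :=
    Continuous.rpow_const (by fun_prop) fun _ => Or.inr hγ
  exact (h1.mul h2).mul h3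

lemma IsAngelescoInterval.weight_endpoints (h : IsAngelescoInterval a u v s)
    (hα : α ≠ 0) (hβ : β ≠ 0) (hγ : γ ≠ 0) :
    angelescoWeight a α β γ u = 0 ∧ angelescoWeight a α β γ v = 0 := by
  rcases h with ⟨rfl, rfl, -⟩ | ⟨rfl, rfl, -⟩ <;>
    simp [angelescoWeight, Real.zero_rpow, hα, hβ, hγ]

/-- The sign `-s` arises from `|x| = s * x` and `1 - x = -(x - 1)`. -/
lemma IsAngelescoInterval.weight_add_one (h : IsAngelescoInterval a u v s) (ha : a < 0) {x : ℝ}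
    (hx : x ∈ Ioo u v) :
    angelescoWeight a (α + 1) (β + 1) (γ + 1) x =
      -s * ((x - a) * x * (x - 1)) * angelescoWeight a α β γ x := by
  obtain ⟨h1, h2, h3, h4⟩ := h.bounds ha hx
  rw [angelescoWeight, angelescoWeight, Real.rpow_add_one (by linarith),
    Real.rpow_add_one (by simpa), Real.rpow_add_one (by linarith)]
  nth_rewrite 2 [h4]
  ring

lemma IsAngelescoInterval.hasDerivAt_weight (h : IsAngelescoInterval a u v s) (ha : a < 0) {x : ℝ}
    (hx : x ∈ Ioo u v) :
    HasDerivAt (angelescoWeight a (α + 1) (β + 1) (γ + 1))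
      (-s * ((α + 1) * (x * (x - 1)) + (β + 1) * ((x - a) * (x - 1)) +
        (γ + 1) * ((x - a) * x)) * angelescoWeight a α β γ x) x := by
  obtain ⟨h1, h2, h3, h4⟩ := h.bounds ha hx
  have d1 : HasDerivAt (fun x : ℝ => (x - a) ^ (α + 1)) (1 * (α + 1) * (x - a) ^ (α + 1 - 1)) x :=
    ((hasDerivAt_id x).sub_const a).rpow_const (Or.inl (by simpa using (sub_pos.2 h1).ne'))
  have dabs : HasDerivAt (fun x : ℝ => |x|) s x := by
    have : HasDerivAt (fun x : ℝ => s * x) s x := by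
      simpa using (hasDerivAt_id x).const_mul s
    refine this.congr_of_eventuallyEq ?_
    filter_upwards [isOpen_Ioo.mem_nhds hx] with y hy
    exact (h.bounds ha hy).2.2.2
  have d2 : HasDerivAt (fun x : ℝ => |x| ^ (β + 1)) (s * (β + 1) * |x| ^ (β + 1 - 1)) x :=
    dabs.rpow_const (Or.inl (by simpa))
  have d3 : HasDerivAt (fun x : ℝ => (1 - x) ^ (γ + 1))
      (-1 * (γ + 1) * (1 - x) ^ (γ + 1 - 1)) x :=
    ((hasDerivAt_id x).const_sub 1).rpow_const (Or.inl (by simpa using (sub_pos.2 h2).ne'))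
  refine ((d1.mul d2).mul d3).congr_deriv ?_
  simp only [add_sub_cancel_right, Pi.mul_apply]
  rw [angelescoWeight, Real.rpow_add_one (sub_pos.2 h1).ne',
    Real.rpow_add_one (abs_ne_zero.2 h3), Real.rpow_add_one (sub_pos.2 h2).ne']
  have h5 : |x| ^ β * |x| = s * x * |x| ^ β := by rw [mul_comm]; nth_rewrite 1 [h4]; rfl
  rw [h5]
  ring

/-- Integration by parts against the weight with raised exponents. -/
lemma IsAngelescoInterval.integral_raise (h : IsAngelescoInterval a u v s) (ha : a < 0)
    (hα : -1 < α) (hβ : -1 < β) (hγ : -1 < γ) (q P : ℝ[X]) :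
    ∫ x in u..v, q.eval x *
        ((X - C a) * X * (X - C 1) * derivative P +
          (C (α + 1) * (X * (X - C 1)) + C (β + 1) * ((X - C a) * (X - C 1)) +
            C (γ + 1) * ((X - C a) * X)) * P).eval x * angelescoWeight a α β γ x =
      s * ∫ x in u..v, (derivative q).eval x * P.eval x *
        angelescoWeight a (α + 1) (β + 1) (γ + 1) x := by
  set R : ℝ[X] := (X - C a) * X * (X - C 1) * derivative P +
          (C (α + 1) * (X * (X - C 1)) + C (β + 1) * ((X - C a) * (X - C 1)) +
            C (γ + 1) * ((X - C a) * X)) * P with hR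
  have hI1 : IntervalIntegrable (fun x => (q.eval x * R.eval x) * angelescoWeight a α β γ x)
      volume u v := h.intervalIntegrable ha hα hβ hγ (q.continuous.mul R.continuous)
  have hI2 : IntervalIntegrable (fun x => ((derivative q).eval x * P.eval x) *
      angelescoWeight a (α + 1) (β + 1) (γ + 1) x) volume u v :=
    h.intervalIntegrable ha (by linarith) (by linarith) (by linarith)
      ((derivative q).continuous.mul P.continuous)
  have key := intervalIntegral.integral_eq_sub_of_hasDerivAt_of_le (h.lt ha).le
    (f := fun x => q.eval x * P.eval x * angelescoWeight a (α + 1) (β + 1) (γ + 1) x)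
    (f' := fun x => (derivative q).eval x * P.eval x *
      angelescoWeight a (α + 1) (β + 1) (γ + 1) x -
      s * (q.eval x * R.eval x * angelescoWeight a α β γ x))
    ((q.continuous.mul P.continuous).mul (continuous_angelescoWeight
      (by linarith) (by linarith) (by linarith))).continuousOn
    (fun x hx => by
      refine (((q.hasDerivAt x).mul (P.hasDerivAt x)).mul
        (h.hasDerivAt_weight ha hx)).congr_deriv ?_
      simp only [Pi.mul_apply, h.weight_add_one ha hx, hR, eval_add, eval_mul, eval_sub, eval_X,
        eval_C]
      ring)
    (hI2.sub (hI1.const_mul s))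
  -- The raised exponents are nonzero, so the boundary terms vanish.
  obtain ⟨e1, e2⟩ := h.weight_endpoints (α := α + 1) (β := β + 1) (γ := γ + 1)
    (by linarith) (by linarith) (by linarith)
  rw [intervalIntegral.integral_sub hI2 (hI1.const_mul s), intervalIntegral.integral_const_mul,
    e1, e2] at key
  have := h.mul_self
  set I1 := ∫ x in u..v, q.eval x * R.eval x * angelescoWeight a α β γ x
  have e3 : (∫ x in u..v, (derivative q).eval x * P.eval x *
    angelescoWeight a (α + 1) (β + 1) (γ + 1) x) = s * I1 := by linarith
  rw [e3, ← mul_assoc, this, one_mul]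

/-- Orthogonality of `P` to the polynomials of degree less than `n`. -/
def IsOrthogonalOn (n : ℕ) (a α β γ u v : ℝ) (P : ℝ[X]) : Prop :=
  ∀ k < n, ∫ x in u..v, x ^ k * P.eval x * angelescoWeight a α β γ x = 0

lemma IsOrthogonalOn.integral_eq_zero {n : ℕ} {P : ℝ[X]} (hP : IsOrthogonalOn n a α β γ u v P)
    (h : IsAngelescoInterval a u v s) (ha : a < 0)
    (hα : -1 < α) (hβ : -1 < β) (hγ : -1 < γ) {q : ℝ[X]} (hq : q.natDegree < n) :
    ∫ x in u..v, q.eval x * P.eval x * angelescoWeight a α β γ x = 0 := by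
  have e : ∀ x, q.eval x * P.eval x * angelescoWeight a α β γ x =
      ∑ i ∈ Finset.range n, q.coeff i * (x ^ i * P.eval x * angelescoWeight a α β γ x) := by
    intro x
    rw [eval_eq_sum_range' hq, Finset.sum_mul, Finset.sum_mul]
    exact Finset.sum_congr rfl fun i _ => by ring
  simp_rw [e]
  rw [intervalIntegral.integral_finsetSum]
  · refine Finset.sum_eq_zero fun i hi => ?_
    rw [intervalIntegral.integral_const_mul, hP i (by simpa using hi), mul_zero]
  · intro i _
    exact (h.intervalIntegrable ha hα hβ hγ ((continuous_pow i).mul P.continuous)).const_mul _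

/-- Integration by parts replaces `x ^ k` by a multiple of `x ^ (k - 1)`, and by `0` when `k = 0`;
hence one more orthogonality condition is gained. -/
lemma IsOrthogonalOn.raise {n : ℕ} {P : ℝ[X]}
    (hP : IsOrthogonalOn n a (α + 1) (β + 1) (γ + 1) u v P)
    (h : IsAngelescoInterval a u v s) (ha : a < 0) (hα : -1 < α) (hβ : -1 < β) (hγ : -1 < γ) :
    IsOrthogonalOn (n + 1) a α β γ u v ((X - C a) * X * (X - C 1) * derivative P +
      (C (α + 1) * (X * (X - C 1)) + C (β + 1) * ((X - C a) * (X - C 1)) +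
        C (γ + 1) * ((X - C a) * X)) * P) := by
  intro k hk
  have := h.integral_raise ha hα hβ hγ (X ^ k) P
  simp only [eval_pow, eval_X] at this
  rw [this]
  refine mul_eq_zero_of_right _ ?_
  cases k with
  | zero => simp
  | succ k =>
    have e : ∀ x : ℝ, (derivative (X ^ (k + 1) : ℝ[X])).eval x * P.eval x *
        angelescoWeight a (α + 1) (β + 1) (γ + 1) x =
        (k + 1 : ℝ) * (x ^ k * P.eval x * angelescoWeight a (α + 1) (β + 1) (γ + 1) x) := by
      intro x
      simp
      ring
    simp_rw [e]
    rw [intervalIntegral.integral_const_mul, hP k (by omega), mul_zero]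

lemma exists_eq_mul_of_filter_roots (D : ℝ[X]) (hD : D ≠ 0) (u v : ℝ) :
    ∃ r g : ℝ[X], D = r * g ∧ r ≠ 0 ∧
      r.natDegree = (D.roots.filter (· ∈ Ioo u v)).card ∧ ∀ x ∈ Ioo u v, g.eval x ≠ 0 := by
  classical
  obtain ⟨q, hq, -, hq0⟩ := D.exists_prod_multiset_X_sub_C_mul
  have hqne : q ≠ 0 := by rintro rfl; simp at hq; exact hD hq.symm
  refine ⟨((D.roots.filter (· ∈ Ioo u v)).map fun t => X - C t).prod,
    ((D.roots.filter (¬ · ∈ Ioo u v)).map fun t => X - C t).prod * q, ?_, ?_, ?_, ?_⟩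
  · rw [← mul_assoc, ← Multiset.prod_add, ← Multiset.map_add, Multiset.filter_add_not, hq]
  · exact (monic_multisetProd_X_sub_C _).ne_zero
  · exact natDegree_multiset_prod_X_sub_C_eq_card _
  · intro x hx
    rw [eval_mul]
    refine mul_ne_zero ?_ fun h0 => ?_
    · rw [eval_multiset_prod, Multiset.map_map]
      intro h0
      rw [Multiset.prod_eq_zero_iff, Multiset.mem_map] at h0
      obtain ⟨t, ht, h0⟩ := h0
      simp only [Function.comp, eval_sub, eval_X, eval_C, sub_eq_zero] at h0
      subst h0
      exact (Multiset.mem_filter.1 ht).2 hx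
    · have : x ∈ q.roots := (mem_roots hqne).2 h0
      simp [hq0] at this

/-- With fewer than `n` roots inside, counted with multiplicity, let `r` be the product of their
linear factors and `D = r * g`. Then `g` has constant sign on the interval, so the integral of `r *
D = r ^ 2 * g` against the weight is nonzero, contradicting orthogonality to `r`. -/
lemma IsOrthogonalOn.le_card_roots {n : ℕ} {D : ℝ[X]} (hD : IsOrthogonalOn n a α β γ u v D)
    (hD0 : D ≠ 0) (h : IsAngelescoInterval a u v s) (ha : a < 0)
    (hα : -1 < α) (hβ : -1 < β) (hγ : -1 < γ) :
    n ≤ (D.roots.filter (· ∈ Ioo u v)).card := by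
  by_contra! hlt
  obtain ⟨r, g, hrg, hr0, hr, hg⟩ := exists_eq_mul_of_filter_roots D hD0 u v
  have huv := h.lt ha
  have hint := hD.integral_eq_zero h ha hα hβ hγ (hr.trans_lt hlt)
  set f : ℝ → ℝ := fun x => r.eval x * D.eval x * angelescoWeight a α β γ x with hf
  have hfI : IntervalIntegrable f volume u v :=
    h.intervalIntegrable ha hα hβ hγ (r.continuous.mul D.continuous)
  have hfeq : ∀ x, f x = (r.eval x) ^ 2 * angelescoWeight a α β γ x * g.eval x := by
    intro x; simp only [hf]; rw [congrArg (eval x) hrg, eval_mul]; ring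
  have hw : ∀ x ∈ Ioo u v, 0 < angelescoWeight a α β γ x := fun x hx =>
    let ⟨h1, h2, h3, _⟩ := h.bounds ha hx
    angelescoWeight_pos h1 h3 h2
  have hsign : (∀ x ∈ Ioo u v, 0 < g.eval x) ∨ ∀ x ∈ Ioo u v, g.eval x < 0 := by
    by_contra! hcon
    obtain ⟨⟨x, hx, hx0⟩, y, hy, hy0⟩ := hcon
    obtain ⟨t, ht, ht0⟩ := isPreconnected_Ioo.intermediate_value hx hy
      g.continuous.continuousOn ⟨hx0, hy0⟩
    exact hg t ht ht0
  have hsupp : ∀ F : ℝ → ℝ, (∀ x ∈ Ioo u v, r.eval x ≠ 0 → F x ≠ 0) →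
      0 < volume (Function.support F ∩ Ioc u v) := by
    intro F hF
    have hsub : Ioo u v \ (r.roots.toFinset : Set ℝ) ⊆ Function.support F ∩ Ioc u v := by
      rintro x ⟨hx, hxr⟩
      refine ⟨hF x hx fun h0 => hxr ?_, hx.1, hx.2.le⟩
      simpa [hr0] using h0
    refine lt_of_lt_of_le ?_ (measure_mono hsub)
    rw [measure_sdiff_null (Finset.measure_zero _ _), Real.volume_Ioo]
    simpa using huv
  have hnull : ∀ F : ℝ → ℝ, IntervalIntegrable F volume u v → (∀ x ∈ Ioo u v, 0 ≤ F x) →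
      (∀ x ∈ Ioo u v, r.eval x ≠ 0 → F x ≠ 0) → (∫ x in u..v, F x) ≠ 0 := by
    intro F hFI hF0 hF
    refine ne_of_gt ?_
    rw [intervalIntegral.integral_pos_iff_support_of_nonneg_ae' ?_ hFI]
    · exact ⟨huv, hsupp F hF⟩
    · rw [uIoc_of_le huv.le, restrict_Ioo_eq_restrict_Ioc.symm]
      exact (ae_restrict_iff' measurableSet_Ioo).2 (Filter.Eventually.of_forall hF0)
  rcases hsign with hs | hs
  · refine hnull f hfI (fun x hx => ?_) (fun x hx hr => ?_) hint
    · rw [hfeq]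
      exact mul_nonneg (mul_nonneg (sq_nonneg _) (hw x hx).le) (hs x hx).le
    · rw [hfeq]
      exact mul_ne_zero (mul_ne_zero (pow_ne_zero _ hr) (hw x hx).ne') (hs x hx).ne'
  · refine hnull (fun x => -f x) hfI.neg (fun x hx => ?_) (fun x hx hr => ?_) ?_
    · rw [hfeq, ← mul_neg]
      exact mul_nonneg (mul_nonneg (sq_nonneg _) (hw x hx).le) (neg_pos.2 (hs x hx)).le
    · rw [hfeq]
      exact neg_ne_zero.2 (mul_ne_zero (mul_ne_zero (pow_ne_zero _ hr) (hw x hx).ne') (hs x hx).ne)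
    · rw [intervalIntegral.integral_neg, hint, neg_zero]

end Weight

/-! ### Uniqueness, and the recursive zeros as the actual zeros -/

section Polynomial

variable {n : ℕ} {a α β γ : ℝ} {P Q : ℝ[X]}

lemma isJacobiAngelesco_iff :
    IsJacobiAngelesco n n a α β γ P ↔ P.Monic ∧ P.natDegree = 2 * n ∧
      IsOrthogonalOn n a α β γ a 0 P ∧ IsOrthogonalOn n a α β γ 0 1 P := by
  have e : ∀ k : ℕ, ∫ x in (0 : ℝ)..1, x ^ k * P.eval x * angelescoWeight a α β γ x =
      ∫ x in (0 : ℝ)..1, x ^ k * P.eval x * ((x - a) ^ α * x ^ β * (1 - x) ^ γ) := by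
    intro k
    refine intervalIntegral.integral_congr fun x hx => ?_
    rw [uIcc_of_le zero_le_one] at hx
    simp only [angelescoWeight, abs_of_nonneg hx.1]
  constructor
  · rintro ⟨h1, h2, h3, h4⟩
    exact ⟨h1, by omega, h3, fun k hk => (e k).trans (h4 k hk)⟩
  · rintro ⟨h1, h2, h3, h4⟩
    exact ⟨h1, by omega, h3, fun k hk => (e k).symm.trans (h4 k hk)⟩

lemma IsOrthogonalOn.sub {u v s : ℝ} (hP : IsOrthogonalOn n a α β γ u v P)
    (hQ : IsOrthogonalOn n a α β γ u v Q) (h : IsAngelescoInterval a u v s) (ha : a < 0)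
    (hα : -1 < α) (hβ : -1 < β) (hγ : -1 < γ) : IsOrthogonalOn n a α β γ u v (P - Q) := by
  intro k hk
  have hI : ∀ R : ℝ[X], IntervalIntegrable
      (fun x => x ^ k * R.eval x * angelescoWeight a α β γ x) MeasureTheory.volume u v :=
    fun R => h.intervalIntegrable ha hα hβ hγ ((continuous_pow k).mul R.continuous)
  simp_rw [eval_sub, mul_sub, sub_mul]
  rw [intervalIntegral.integral_sub (hI P) (hI Q), hP k hk, hQ k hk, sub_zero]

/-- A nonzero difference would have degree below `2 * n` but at least `n` roots in each of two
disjoint intervals. -/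
lemma IsJacobiAngelesco.eq (ha : a < 0) (hα : -1 < α) (hβ : -1 < β) (hγ : -1 < γ)
    (hP : IsJacobiAngelesco n n a α β γ P) (hQ : IsJacobiAngelesco n n a α β γ Q) : P = Q := by
  classical
  rw [isJacobiAngelesco_iff] at hP hQ
  obtain ⟨p1, p2, p3, p4⟩ := hP
  obtain ⟨q1, q2, q3, q4⟩ := hQ
  by_contra hne
  have hD0 : P - Q ≠ 0 := sub_ne_zero.2 hne
  have i1 : IsAngelescoInterval a a 0 (-1) := Or.inl ⟨rfl, rfl, rfl⟩
  have i2 : IsAngelescoInterval a 0 1 1 := Or.inr ⟨rfl, rfl, rfl⟩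
  have c1 := (p3.sub q3 i1 ha hα hβ hγ).le_card_roots hD0 i1 ha hα hβ hγ
  have c2 := (p4.sub q4 i2 ha hα hβ hγ).le_card_roots hD0 i2 ha hα hβ hγ
  have hdeg : (P - Q).degree < (2 * n : ℕ) := by
    have hd : P.degree = Q.degree := by
      rw [degree_eq_natDegree p1.ne_zero, degree_eq_natDegree q1.ne_zero, p2, q2]
    have := degree_sub_lt_left hd p1.ne_zero (by rw [p1.leadingCoeff, q1.leadingCoeff])
    rwa [degree_eq_natDegree p1.ne_zero, p2] at this
  have hcard := card_roots hD0
  have c3 : ((P - Q).roots.filter (· ∈ Ioo (0 : ℝ) 1)).card ≤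
      ((P - Q).roots.filter (¬ · ∈ Ioo a 0)).card :=
    Multiset.card_le_card (Multiset.monotone_filter_right _ fun x hx hx' =>
      absurd hx.1 (not_lt.2 hx'.2.le))
  have c4 : ((P - Q).roots.filter (· ∈ Ioo a 0)).card +
      ((P - Q).roots.filter (¬ · ∈ Ioo a 0)).card = (P - Q).roots.card := by
    rw [← Multiset.card_add, Multiset.filter_add_not]
  have := hcard.trans_lt hdeg
  rw [Nat.cast_lt] at this
  omega

/-- The raised polynomial equals the total residue times `∏ (X - y i)`; that total is positive, so
it can be divided out of the orthogonality relations. -/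
lemma IsZeroSeq.isJacobiAngelesco (ha : a < 0) (n : ℕ) : ∀ {α β γ : ℝ} {z : ℕ → ℝ},
    -1 < α → -1 < β → -1 < γ → IsZeroSeq a n α β γ z →
    IsJacobiAngelesco n n a α β γ (∏ i ∈ Finset.range (2 * n), (X - C (z i))) := by
  induction n with
  | zero =>
    intros
    exact ⟨by simp, by simp, fun k hk => absurd hk (by simp), fun k hk => absurd hk (by simp)⟩
  | succ n ih =>
    intro α β γ y hα hβ hγ ⟨z, hz, hy⟩
    have hP := isJacobiAngelesco_iff.1 (ih (by linarith) (by linarith) (by linarith) hz)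
    have hM := sum_nodeWeight_pos (n := n) (by linarith : 0 < α + 1) (by linarith : 0 < β + 1)
      (by linarith : 0 < γ + 1)
    have hfac := poleNumerator_eq_prod (hz.node_strictMonoOn ha)
      (m := nodeWeight n (α + 1) (β + 1) (γ + 1)) (fun k hk => (hy k hk).1) fun k hk => (hy k hk).2
    rw [poleNumerator_node] at hfac
    have key : ∀ u v s : ℝ, IsAngelescoInterval a u v s →
        IsOrthogonalOn n a (α + 1) (β + 1) (γ + 1) u v
          (∏ i ∈ Finset.range (2 * n), (X - C (z i))) →
        IsOrthogonalOn (n + 1) a α β γ u v (∏ i ∈ Finset.range (2 * n + 2), (X - C (y i))) := by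
      intro u v s h horth k hk
      have h1 := horth.raise h ha hα hβ hγ k hk
      rw [hfac] at h1
      have e : ∀ x : ℝ, x ^ k * (C (∑ i ∈ Finset.range (2 * n + 2 + 1),
          nodeWeight n (α + 1) (β + 1) (γ + 1) i) *
          ∏ i ∈ Finset.range (2 * n + 2), (X - C (y i))).eval x * angelescoWeight a α β γ x =
          (∑ i ∈ Finset.range (2 * n + 2 + 1), nodeWeight n (α + 1) (β + 1) (γ + 1) i) *
          (x ^ k * (∏ i ∈ Finset.range (2 * n + 2), (X - C (y i))).eval x *
            angelescoWeight a α β γ x) := by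
        intro x
        rw [eval_mul, eval_C]
        ring
      simp_rw [e] at h1
      rw [intervalIntegral.integral_const_mul] at h1
      exact (mul_eq_zero.1 h1).resolve_left hM.ne'
    refine isJacobiAngelesco_iff.2 ⟨monic_prod_X_sub_C _ _, by simp,
      key _ _ _ (Or.inl ⟨rfl, rfl, rfl⟩) hP.2.2.1, key _ _ _ (Or.inr ⟨rfl, rfl, rfl⟩) hP.2.2.2⟩

lemma IsZeroSeq.jacobiAngelesco_eq (ha : a < 0) (hα : -1 < α) (hβ : -1 < β) (hγ : -1 < γ)
    {z : ℕ → ℝ} (hz : IsZeroSeq a n α β γ z) :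
    jacobiAngelesco n n a α β γ = ∏ i ∈ Finset.range (2 * n), (X - C (z i)) := by
  have h := hz.isJacobiAngelesco ha n hα hβ hγ
  exact IsJacobiAngelesco.eq ha hα hβ hγ (Classical.epsilon_spec ⟨_, h⟩) h

lemma IsZeroSeq.jacobiAngelescoZero_eq (ha : a < 0) (hα : -1 < α) (hβ : -1 < β) (hγ : -1 < γ)
    {z : ℕ → ℝ} (hz : IsZeroSeq a n α β γ z) (j : Fin (2 * n)) :
    jacobiAngelescoZero n a α β γ j = z j := by
  have hroots : (jacobiAngelesco n n a α β γ).roots =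
      ((List.range (2 * n)).map z : Multiset ℝ) := by
    rw [hz.jacobiAngelesco_eq ha hα hβ hγ, ← Multiset.map_coe,
      ← roots_multiset_prod_X_sub_C (Multiset.map z _), Multiset.map_map]
    rfl
  have hsorted : ((List.range (2 * n)).map z).Pairwise (· ≤ ·) := by
    rw [List.pairwise_map]
    refine List.Pairwise.imp_of_mem ?_ List.pairwise_lt_range
    intro i k _ hk hik
    exact (hz.lt_of_lt ha hik (by simpa using hk)).le
  have hsort : (jacobiAngelesco n n a α β γ).roots.sort (· ≤ ·) = (List.range (2 * n)).map z := by
    rw [hroots]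
    refine List.Perm.eq_of_pairwise' (Multiset.pairwise_sort _ _) hsorted ?_
    exact Multiset.coe_eq_coe.1 (Multiset.sort_eq _ _)
  rw [jacobiAngelescoZero, hsort]
  simp [List.getD]

end Polynomial

/-! ### The main theorem -/

theorem mainTheorem1 (n : ℕ) (hn : 1 ≤ n) (a : ℝ) (ha : a < 0) :
    -- the polynomials and their zeros are well defined
    (∀ α β γ : ℝ, -1 < α → -1 < β → -1 < γ →
      (∃! P : ℝ[X], IsJacobiAngelesco n n a α β γ P) ∧
      IsJacobiAngelesco n n a α β γ (jacobiAngelesco n n a α β γ) ∧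
      StrictMono (jacobiAngelescoZero n a α β γ) ∧
      (∀ t : ℝ, (jacobiAngelesco n n a α β γ).eval t = 0 ↔
        ∃ j, jacobiAngelescoZero n a α β γ j = t) ∧
      (∀ j : Fin (2 * n), (j : ℕ) < n → jacobiAngelescoZero n a α β γ j ∈ Ioo a 0) ∧
      (∀ j : Fin (2 * n), n ≤ (j : ℕ) → jacobiAngelescoZero n a α β γ j ∈ Ioo 0 1)) ∧
    -- all the zeros increase with `α`
    (∀ β γ : ℝ, -1 < β → -1 < γ → ∀ j : Fin (2 * n),
      StrictMonoOn (fun α => jacobiAngelescoZero n a α β γ j) (Ioi (-1))) ∧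
    -- in the symmetric case, the negative zeros decrease and the positive ones increase with `β`
    (a = -1 → ∀ α : ℝ, -1 < α →
      (∀ j : Fin (2 * n), (j : ℕ) < n →
        StrictAntiOn (fun β => jacobiAngelescoZero n a α β α j) (Ioi (-1))) ∧
      (∀ j : Fin (2 * n), n ≤ (j : ℕ) →
        StrictMonoOn (fun β => jacobiAngelescoZero n a α β α j) (Ioi (-1)))) ∧
    -- all the zeros decrease with `γ`
    (∀ α β : ℝ, -1 < α → -1 < β → ∀ j : Fin (2 * n),
      StrictAntiOn (fun γ => jacobiAngelescoZero n a α β γ j) (Ioi (-1))) := by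
  refine ⟨fun α β γ hα hβ hγ => ?_, fun β γ hβ hγ j α hα α' hα' hlt => ?_, ?_,
    fun α β hα hβ j γ hγ γ' hγ' hlt => ?_⟩
  · obtain ⟨z, hz⟩ := exists_isZeroSeq ha n hα hβ hγ
    have heq := hz.jacobiAngelesco_eq ha hα hβ hγ
    have hzero := hz.jacobiAngelescoZero_eq ha hα hβ hγ
    have hP : IsJacobiAngelesco n n a α β γ (jacobiAngelesco n n a α β γ) :=
      heq ▸ hz.isJacobiAngelesco ha n hα hβ hγ
    refine ⟨⟨_, hP, fun Q hQ => hQ.eq ha hα hβ hγ hP⟩, hP, fun i j hij => ?_, fun t => ?_,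
      fun j hj => ?_, fun j hj => ?_⟩
    · rw [hzero, hzero]
      exact hz.lt_of_lt ha hij j.2
    · simp only [heq, hzero, eval_prod, eval_sub, eval_X, eval_C, Finset.prod_eq_zero_iff,
        Finset.mem_range, sub_eq_zero]
      exact ⟨fun ⟨i, hi, h⟩ => ⟨⟨i, hi⟩, h.symm⟩, fun ⟨j, h⟩ => ⟨j, j.2, h.symm⟩⟩
    · rw [hzero]
      exact hz.mem_Ioo_left ha hj
    · rw [hzero]
      exact hz.mem_Ioo_right ha hj j.2
  · obtain ⟨z, hz⟩ := exists_isZeroSeq ha n hα hβ hγ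
    obtain ⟨z', hz'⟩ := exists_isZeroSeq ha n hα' hβ hγ
    simp only [hz.jacobiAngelescoZero_eq ha hα hβ hγ, hz'.jacobiAngelescoZero_eq ha hα' hβ hγ]
    exact IsZeroSeq.lt_of_alpha_le_of_gamma_le ha n hα hβ hγ hlt.le le_rfl (Or.inl hlt) hz hz' j j.2
  · rintro rfl α hα
    have key : ∀ j : Fin (2 * n), n ≤ (j : ℕ) →
        StrictMonoOn (fun β => jacobiAngelescoZero n (-1) α β α j) (Ioi (-1)) := by
      intro j hj β hβ β' hβ' hlt
      obtain ⟨z, hz⟩ := exists_isZeroSeq ha n hα hβ hα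
      obtain ⟨z', hz'⟩ := exists_isZeroSeq ha n hα hβ' hα
      simp only [hz.jacobiAngelescoZero_eq ha hα hβ hα, hz'.jacobiAngelescoZero_eq ha hα hβ' hα]
      exact IsZeroSeq.lt_of_beta_lt n hα hβ hlt hz hz' j j.2 hj
    refine ⟨fun j hj β hβ β' hβ' hlt => ?_, key⟩
    -- Reversing the index reflects the zeros in `0`, so the negative zeros inherit the result for
    -- the positive ones with the opposite direction.
    have hneg : ∀ β : ℝ, -1 < β → jacobiAngelescoZero n (-1) α β α j.rev =
        -jacobiAngelescoZero n (-1) α β α j := by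
      intro β hβ
      obtain ⟨z, hz⟩ := exists_isZeroSeq ha n hα hβ hα
      rw [hz.jacobiAngelescoZero_eq ha hα hβ hα, hz.jacobiAngelescoZero_eq ha hα hβ hα,
        ← hz.symm n hα hβ j j.2, Fin.val_rev]
      congr 1; omega
    have := key j.rev (by rw [Fin.val_rev]; omega) hβ hβ' hlt
    simp only [hneg β hβ, hneg β' hβ'] at this
    exact neg_lt_neg_iff.1 this
  · obtain ⟨z, hz⟩ := exists_isZeroSeq ha n hα hβ hγ
    obtain ⟨z', hz'⟩ := exists_isZeroSeq ha n hα hβ hγ'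
    simp only [hz.jacobiAngelescoZero_eq ha hα hβ hγ, hz'.jacobiAngelescoZero_eq ha hα hβ hγ']
    exact IsZeroSeq.lt_of_alpha_le_of_gamma_le ha n hα hβ hγ le_rfl hlt.le (Or.inr hlt) hz' hz j j.2
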